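/- Let $q$ be a positive square-free integer with $q\equiv 3 \pmod 8$ all of whose prime factors are congruent to $1$ or $3$ modulo $8$, and let $K=\mathbb{Q}(\sqrt2,\sqrt{-q})\subset\mathbb{C}$. Then $K$ is a totally imaginary field of degree $4$ over $\mathbb{Q}$, and $$\alpha_1=1,\quad \alpha_2=\sqrt2,\quad \alpha_3=\frac{1+i\sqrt q}{2},\quad \alpha_4=\frac{\sqrt2+i\sqrt{2q}}{2}$$ is a $\mathbb{Z}$-basis of its ring of integers $\mathcal{O}_K$. There exists an integer $j$ with $j^2\equiv-2\pmod q$. For every such $j$, the $\mathbb{Z}$-module $$M_{j,q}=\Big\{x=\sum_{i=1}^4x_i\alpha_i\in\mathcal{O}_K \;:\; x_i\in\mathbb{Z},\ x_3\equiv-2x_1+j(2x_2+x_4)\pmod q\Big\}$$ has index $q$ in $\mathcal{O}_K$. Order the four embeddings of $K$ into $\mathbb{C}$ as $\sigma_1,\sigma_2,\sigma_3,\sigma_4$ with $\overline{\sigma_3}=\sigma_1$ and $\overline{\sigma_4}=\sigma_2$ (such orderings exist), and let $\sigma_K(x)=(\Re\sigma_1(x),\Im\sigma_1(x),\Re\sigma_2(x),\Im\sigma_2(x))$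 be the corresponding canonical embedding $K\to\mathbb{R}^4$. For every such ordering, the lattice $\sigma_K(M_{j,q})$ is equivalent (similar) to $D_4=\{z\in\mathbb{Z}^4 : z_1+z_2+z_3+z_4 \text{ even}\}$, that is, there are a real number $c>0$ and a linear isometry $f$ of Euclidean space $\mathbb{R}^4$ with $c\,f(\sigma_K(M_{j,q}))=D_4$. Moreover, there are infinitely many such integers $q$, and distinct such $q$ give non-isomorphic fields $\mathbb{Q}(\sqrt2,\sqrt{-q})$; thus $D_4$ is realized in this way by infinitely many pairwise non-isomorphic totally imaginary biquadratic fields. -/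

import Mathlib

open NumberField

/-- Similarity of lattices in Euclidean `n`-space: one is carried onto the other by
a linear isometry (rotation or reflection) followed by a change of scale. -/
def LatticeEquivalent {n : ℕ} (L₁ L₂ : Submodule ℤ (EuclideanSpace ℝ (Fin n))) : Prop :=
  ∃ (c : ℝ) (f : EuclideanSpace ℝ (Fin n) ≃ₗᵢ[ℝ] EuclideanSpace ℝ (Fin n)),
    0 < c ∧ (fun x => c • f x) '' (L₁ : Set (EuclideanSpace ℝ (Fin n))) = L₂

/-- The lattice `D_n`: integer vectors whose coordinate sum is even. -/
def latticeD (n : ℕ) : Submodule ℤ (EuclideanSpace ℝ (Fin n)) where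
  carrier := {x | ∃ z : Fin n → ℤ, (∀ i, x i = (z i : ℝ)) ∧ Even (∑ i, z i)}
  zero_mem' := ⟨0, by simp, by simp⟩
  add_mem' := by
    rintro x y ⟨z, hz, hze⟩ ⟨w, hw, hwe⟩
    refine ⟨z + w, fun i => by simp [hz, hw], ?_⟩
    simpa [Finset.sum_add_distrib] using hze.add hwe
  smul_mem' := by
    rintro c x ⟨z, hz, hze⟩
    refine ⟨c • z, fun i => by simp [hz], ?_⟩
    simpa [← Finset.mul_sum] using hze.mul_left c

/-- An ordering `σ₁, σ₂, σ₃, σ₄` of all the embeddings of a totally complex quartic field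
into `ℂ`, such that `σ₃` and `σ₄` are the complex conjugates of `σ₁` and `σ₂`
(indices are shifted to start from `0`). -/
structure EmbeddingOrdering (K : Type*) [Field K] where
  toEquiv : Fin 4 ≃ (K →+* ℂ)
  conj_two : ComplexEmbedding.conjugate (toEquiv 2) = toEquiv 0
  conj_three : ComplexEmbedding.conjugate (toEquiv 3) = toEquiv 1

/-- The canonical embedding `x ↦ (Re σ₁x, Im σ₁x, Re σ₂x, Im σ₂x)` of a totally complex quartic
field into `ℝ⁴`, as a homomorphism of `ℤ`-modules. -/
noncomputable def canonicalEmb {K : Type*} [Field K] (σ : EmbeddingOrdering K) :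
    K →ₗ[ℤ] EuclideanSpace ℝ (Fin 4) :=
  AddMonoidHom.toIntLinearMap
    { toFun := fun x => !₂[(σ.toEquiv 0 x).re, (σ.toEquiv 0 x).im,
        (σ.toEquiv 1 x).re, (σ.toEquiv 1 x).im]
      map_zero' := by ext i; fin_cases i <;> simp
      map_add' := fun x y => by ext i; fin_cases i <;> simp }

/-- The field `ℚ(√2, √-q)`, as a subfield of `ℂ`. -/
noncomputable def fieldK (q : ℕ) : IntermediateField ℚ ℂ :=
  IntermediateField.adjoin ℚ {((√2 : ℝ) : ℂ), Complex.I * ((√(q : ℝ) : ℝ) : ℂ)}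

/-- The numbers `1, √2, (1 + i√q)/2, (√2 + i√(2q))/2`, that is `α₁, α₂, α₃, α₄`
(indices are shifted to start from `0`). -/
noncomputable def alpha (q : ℕ) : Fin 4 → ℂ :=
  ![1, ((√2 : ℝ) : ℂ), (1 + Complex.I * ((√(q : ℝ) : ℝ) : ℂ)) / 2,
    (((√2 : ℝ) : ℂ) + Complex.I * ((√(2 * (q : ℝ)) : ℝ) : ℂ)) / 2]

/-- The `ℤ`-module `M_{j,q}` of all `x = x₁α₁ + x₂α₂ + x₃α₃ + x₄α₄` in the ring of integers with
`x₃ ≡ -2x₁ + j(2x₂ + x₄) (mod q)`. -/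
noncomputable def moduleM (j : ℤ) (q : ℕ) : Submodule ℤ (𝓞 (fieldK q)) where
  carrier := {x | ∃ a : Fin 4 → ℤ, ((x : fieldK q) : ℂ) = ∑ i, (a i : ℂ) * alpha q i ∧
    a 2 ≡ -2 * a 0 + j * (2 * a 1 + a 3) [ZMOD q]}
  zero_mem' := ⟨0, by simp, by simp⟩
  add_mem' := by
    rintro x y ⟨a, ha, ha'⟩ ⟨b, hb, hb'⟩
    refine ⟨a + b, ?_, ?_⟩
    · simp [ha, hb, add_mul, Finset.sum_add_distrib]
    · have h := ha'.add hb'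
      simp only [Pi.add_apply]
      convert h using 1
      ring
  smul_mem' := by
    rintro c x ⟨a, ha, ha'⟩
    refine ⟨c • a, ?_, ?_⟩
    · simp [ha, mul_assoc, Finset.mul_sum]
    · have h := ha'.mul_left c
      simp only [Pi.smul_apply, smul_eq_mul]
      convert h using 1
      ring

/-- The image of `M_{j,q}` in `ℝ⁴` under the canonical embedding. -/
noncomputable def latticeM (j : ℤ) (q : ℕ) (σ : EmbeddingOrdering (fieldK q)) :
    Submodule ℤ (EuclideanSpace ℝ (Fin 4)) :=
  ((moduleM j q).map (Algebra.linearMap (𝓞 (fieldK q)) (fieldK q) |>.restrictScalars ℤ)).map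
    (canonicalEmb σ)

/-- The condition on `q`: square-free, `q ≡ 3 (mod 8)`, and every prime factor of `q` is
`≡ 1` or `3 (mod 8)`. -/
def Admissible (q : ℕ) : Prop :=
  Squarefree q ∧ q ≡ 3 [MOD 8] ∧ ∀ p : ℕ, p.Prime → p ∣ q → p ≡ 1 [MOD 8] ∨ p ≡ 3 [MOD 8]

/-!
Every element of `K = ℚ(√2, √-q)` is `(A + B√2 + C√-q + D√-2q) / 2` with rational `A, B, C, D`,
and its image in `ℝ⁴` has norm squared `(A² + 2B² + q(C² + 2D²)) / 2`, whatever the ordering of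
the embeddings (`EmbeddingOrdering.exists_apply`). It is an algebraic integer exactly if
`A, B, C, D` are integers with `A ≡ C` and `B ≡ D` modulo `2`: the norm and the traces to `ℚ(√2)`
must lie in `ℤ[√2]`, and `q` is squarefree and `≡ 3` modulo `4`
(`fieldK.exists_int_coords_of_isIntegral`).

In these coordinates, `M_{j,q}` is cut out by `A ≡ jB (mod q)`. As `j² ≡ -2 (mod q)`, this says
that `A + B√-2` lies in an ideal of norm `q` of the principal ideal domain `ℤ[√-2]`, and a generator
`r + w√-2` of this ideal is found by Dirichlet approximation (`exists_sq_add_two_mul_sq`,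
`modEq_iff_exists_mul`). If `A + B√-2 = (r + w√-2)(u + v√-2)`, the norm squared becomes
`q(u² + 2v² + C² + 2D²) / 2`. Since `q ≡ 3 (mod 8)`, both `r` and `w` are odd, so the parity
conditions become `u ≡ C` and `u + v ≡ D` modulo `2`, and the integers
`(u + C) / 2, (u - C) / 2, v, D` are subject only to having an even sum
(`modEq_iff_exists_even_sum`). Their squares sum to the norm squared divided by `q`, which is the
similarity with `D₄`.

A square root of `-q'` in `K` is purely imaginary, so that `√q' = (c + d√2)√q` with rational `c, d`;
for odd squarefree `q, q'` this forces `q = q'` (`fieldK.eq_of_mul_self_eq_neg`). All primes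
`≡ 3 (mod 8)` are admissible, and there are infinitely many of them by Dirichlet's theorem.
-/

/-! ### Arithmetic of admissible integers -/

/-- The Chinese remainder theorem reduces the claim to `-2` being a square modulo each prime
factor, which is the supplementary law of quadratic reciprocity for `-2`. -/
theorem isSquare_neg_two_of_primeFactors {n : ℕ} (hn : Squarefree n)
    (H : ∀ p : ℕ, p.Prime → p ∣ n → p % 8 = 1 ∨ p % 8 = 3) : IsSquare (-2 : ZMod n) := by
  induction n using induction_on_primes with
  | zero => exact absurd rfl hn.ne_zero
  | one => exact ⟨0, Subsingleton.elim _ _⟩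
  | prime_mul p n hpp ih =>
    have : Fact p.Prime := ⟨hpp⟩
    have hcp : p.Coprime n := by
      by_contra hc
      exact hpp.not_isUnit (hn p <| mul_dvd_mul_left p <| hpp.dvd_iff_not_coprime.mpr hc)
    have h8 := H p hpp (Nat.dvd_mul_right ..)
    have hp2 : p ≠ 2 := by rintro rfl; omega
    obtain ⟨x, hx⟩ := (ZMod.exists_sq_eq_neg_two_iff hp2).mpr h8
    obtain ⟨y, hy⟩ := ih hn.of_mul_right fun r hr hrn => H r hr (hrn.mul_left p)
    have hpair : IsSquare (-2 : ZMod p × ZMod n) := ⟨(x, y), Prod.ext hx hy⟩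
    have h := hpair.map (ZMod.chineseRemainder hcp).symm
    rwa [map_neg, map_ofNat] at h

theorem Admissible.exists_sq_modEq_neg_two {q : ℕ} (hq : Admissible q) :
    ∃ j : ℤ, j ^ 2 ≡ -2 [ZMOD q] := by
  obtain ⟨x, hx⟩ := isSquare_neg_two_of_primeFactors hq.1 fun p hp hpq => hq.2.2 p hp hpq
  obtain ⟨j, rfl⟩ := ZMod.intCast_surjective x
  refine ⟨j, (ZMod.intCast_eq_intCast_iff _ _ _).mp ?_⟩
  push_cast
  rw [hx, sq]

theorem Admissible.pos {q : ℕ} (hq : Admissible q) : 0 < q := Nat.pos_of_ne_zero hq.1.ne_zero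

theorem Admissible.mod_eight {q : ℕ} (hq : Admissible q) : q % 8 = 3 := hq.2.1

theorem infinite_setOf_admissible : {q : ℕ | Admissible q}.Infinite := by
  have hunit : IsUnit (3 : ZMod 8) := by decide
  refine Set.infinite_of_forall_exists_gt fun n => ?_
  obtain ⟨p, hpn, hp, hp3⟩ := Nat.forall_exists_prime_gt_and_eq_mod hunit n
  have h3 : p ≡ 3 [MOD 8] := (ZMod.natCast_eq_natCast_iff _ _ _).mp (by exact_mod_cast hp3)
  refine ⟨p, ⟨hp.prime.squarefree, h3, fun r hr hrp => ?_⟩, hpn⟩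
  rw [(Nat.prime_dvd_prime_iff_eq hr hp).mp hrp]
  exact Or.inr h3

/-- Modulo `q`, the ratio `j` of two small integers `r, s` found by Dirichlet approximation of
`j / q` makes `r² + 2s²` a positive multiple of `q` below `3q`; if it is `2q`, then `r` is even
and dividing `r + s√-2` by `-√-2` brings the norm down to `q`. -/
theorem exists_sq_add_two_mul_sq {q : ℕ} (hq : Odd q) {j : ℤ} (hj : j ^ 2 ≡ -2 [ZMOD q]) :
    ∃ r s : ℤ, r ^ 2 + 2 * s ^ 2 = q ∧ r ≡ j * s [ZMOD q] := by
  have hq0 : 0 < q := hq.pos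
  have hqR : (0 : ℝ) < q := by exact_mod_cast hq0
  obtain ⟨l, s, hs, hsn, hls⟩ :=
    Real.exists_int_int_abs_mul_sub_le ((j : ℝ) / q) (Nat.sqrt_pos.mpr hq0)
  set n := Nat.sqrt q with hn
  have hnq : n ^ 2 ≤ q := Nat.sqrt_le' q
  have hqn : q < (n + 1) ^ 2 := Nat.lt_succ_sqrt' q
  have hs2 : s ^ 2 ≤ q := by
    have : (n : ℤ) ^ 2 ≤ q := by exact_mod_cast hnq
    nlinarith
  obtain ⟨r, hr⟩ : ∃ r : ℤ, r = s * j - q * l := ⟨_, rfl⟩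
  have hr2 : r ^ 2 < q := by
    have hn1 : (0 : ℝ) < n + 1 := by positivity
    have h1 : |(r : ℝ)| * (n + 1) ≤ q := by
      have : (r : ℝ) = q * (s * (j / q) - l) := by
        rw [hr]; push_cast; field_simp
      rw [this, abs_mul, abs_of_pos hqR]
      rw [le_div_iff₀ hn1] at hls
      nlinarith
    have h2 : (r : ℝ) ^ 2 * (n + 1) ^ 2 ≤ (q : ℝ) ^ 2 := by
      rw [← sq_abs (r : ℝ), ← mul_pow]
      gcongr
    have h3 : (q : ℝ) < (n + 1) ^ 2 := by exact_mod_cast hqn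
    have h4 : (r : ℝ) ^ 2 < q := by
      by_contra hcon
      push Not at hcon
      nlinarith
    exact_mod_cast h4
  have hrs : r ≡ j * s [ZMOD q] := by
    rw [Int.modEq_iff_dvd]
    exact ⟨l, by rw [hr]; ring⟩
  have hdvd : (q : ℤ) ∣ r ^ 2 + 2 * s ^ 2 := by
    rw [← Int.modEq_zero_iff_dvd]
    calc r ^ 2 + 2 * s ^ 2 ≡ (j * s) ^ 2 + 2 * s ^ 2 [ZMOD q] := (hrs.pow 2).add_right _
      _ = j ^ 2 * s ^ 2 + 2 * s ^ 2 := by ring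
      _ ≡ -2 * s ^ 2 + 2 * s ^ 2 [ZMOD q] := (hj.mul_right _).add_right _
      _ = 0 := by ring
  obtain ⟨k, hk⟩ := hdvd
  have hqZ : (0 : ℤ) < q := by exact_mod_cast hq0
  have hk0 : 0 < k := by
    have : 0 < (q : ℤ) * k := by rw [← hk]; positivity
    exact pos_of_mul_pos_right this hqZ.le
  have hk3 : k < 3 := by
    by_contra hcon
    push Not at hcon
    nlinarith
  obtain rfl | rfl : k = 1 ∨ k = 2 := by omega
  · exact ⟨r, s, by linarith, hrs⟩
  · have hre : Even r := by
      have : Even (r ^ 2) := by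
        rw [show r ^ 2 = 2 * (q - s ^ 2) by linarith]; exact even_two_mul _
      exact (Int.even_pow.mp this).1
    obtain ⟨t, ht⟩ := hre.two_dvd
    refine ⟨-s, t, ?_, ?_⟩
    · rw [ht] at hk; linarith
    · have h2 : 2 * -s ≡ 2 * (j * t) [ZMOD q] := by
        calc 2 * -s = -2 * s := by ring
          _ ≡ j ^ 2 * s [ZMOD q] := (hj.mul_right s).symm
          _ = j * (j * s) := by ring
          _ ≡ j * r [ZMOD q] := hrs.symm.mul_left j
          _ = 2 * (j * t) := by rw [ht]; ring
      have hcop : IsCoprime (q : ℤ) 2 := by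
        rw [Int.isCoprime_iff_gcd_eq_one]
        exact_mod_cast (Nat.coprime_two_right.mpr hq)
      rw [Int.modEq_iff_dvd] at h2 ⊢
      rw [← mul_sub] at h2
      exact hcop.dvd_of_dvd_mul_left h2

/-- A squarefree `q` remains squarefree in `ℤ[√2]` when it is odd: if `q` divides
`(m + n√2)²`, then `q` divides `m` and `n`. -/
theorem dvd_of_dvd_sq_add_two_mul_sq {q m n : ℤ} (hq : Squarefree q) (hodd : IsCoprime q 2)
    (h1 : q ∣ m ^ 2 + 2 * n ^ 2) (h2 : q ∣ m * n) : q ∣ m ∧ q ∣ n := by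
  constructor
  · refine (hq.dvd_pow_iff_dvd three_ne_zero).mp ?_
    convert (h1.mul_left m).sub (h2.mul_left (2 * n)) using 1
    ring
  · refine (hq.dvd_pow_iff_dvd three_ne_zero).mp (hodd.dvd_of_dvd_mul_left ?_)
    convert (h1.mul_left n).sub (h2.mul_left m) using 1
    ring

/-- The parity conditions cutting out the ring of integers inside
`{(A + B√2 + C√-q + D√-2q) / 2}`. -/
theorem parity_of_four_dvd {q A B C D : ℤ} (hq : q % 4 = 3)
    (h : 4 ∣ A ^ 2 + 2 * B ^ 2 + q * (C ^ 2 + 2 * D ^ 2)) : 2 ∣ A - C ∧ 2 ∣ B - D := by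
  obtain ⟨k, hk⟩ : ∃ k, q = 4 * k + 3 := ⟨q / 4, by omega⟩
  obtain ⟨l, hl⟩ := h
  subst hk
  rcases Int.even_or_odd' A with ⟨a, rfl | rfl⟩ <;> rcases Int.even_or_odd' B with ⟨b, rfl | rfl⟩ <;>
  rcases Int.even_or_odd' C with ⟨c, rfl | rfl⟩ <;> rcases Int.even_or_odd' D with ⟨d, rfl | rfl⟩ <;>
  ring_nf at hl <;> constructor <;> omega

/-- Both coefficients are odd since squares are `0, 1, 4` modulo `8`. -/
theorem odd_of_sq_add_two_mul_sq {q : ℕ} (hq : q % 8 = 3) {r s : ℤ}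
    (h : r ^ 2 + 2 * s ^ 2 = q) : Odd r ∧ Odd s := by
  have hr : Odd r := by
    rw [← Int.not_even_iff_odd]
    rintro ⟨a, rfl⟩
    ring_nf at h
    omega
  refine ⟨hr, ?_⟩
  rw [← Int.not_even_iff_odd]
  rintro ⟨b, rfl⟩
  have := Int.sq_mod_four_eq_one_of_odd hr
  have h8 := Int.eight_dvd_sq_sub_one_of_odd hr
  ring_nf at h h8
  omega

/-- With `π = r + s√-2` of norm `q` and `r ≡ js`, the lattice `A ≡ jB (mod q)` in `ℤ[√-2]` is
the ideal generated by `π`. -/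
theorem modEq_iff_exists_mul {q : ℕ} (hq : 0 < q) {j r s : ℤ} (hj : j ^ 2 ≡ -2 [ZMOD q])
    (hn : r ^ 2 + 2 * s ^ 2 = q) (hrs : r ≡ j * s [ZMOD q]) (A B : ℤ) :
    A ≡ j * B [ZMOD q] ↔ ∃ u v : ℤ, A = r * u - 2 * s * v ∧ B = r * v + s * u := by
  have hq0 : (q : ℤ) ≠ 0 := by exact_mod_cast hq.ne'
  obtain ⟨m, hm⟩ := hrs.symm.dvd
  obtain ⟨k, hk⟩ := hj.symm.dvd
  constructor
  · intro h
    obtain ⟨l, hl⟩ := h.symm.dvd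
    have hu : r * A + 2 * s * B = q * (k * s * B + j * s * l + m * A) := by
      linear_combination A * hm + j * s * hl + s * B * hk
    have hv : r * B - s * A = q * (m * B - s * l) := by
      linear_combination B * hm - s * hl
    refine ⟨k * s * B + j * s * l + m * A, m * B - s * l, ?_, ?_⟩
    · apply mul_left_cancel₀ hq0
      linear_combination r * hu - 2 * s * hv - A * hn
    · apply mul_left_cancel₀ hq0
      linear_combination r * hv + s * hu - B * hn
  · rintro ⟨u, v, rfl, rfl⟩
    rw [Int.modEq_iff_dvd]
    refine ⟨-(m * u - j * m * v - k * s * v), ?_⟩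
    linear_combination -(u - j * v) * hm + s * v * hk

/-! ### Coordinates and embeddings of the field `ℚ(√2, √-q)` -/

theorem ratCast_add_ratCast_mul_sqrt_two_eq_zero {a b : ℚ} (h : (a : ℝ) + b * √2 = 0) :
    a = 0 ∧ b = 0 := by
  have hb : b = 0 := by
    by_contra hb
    refine irrational_sqrt_two ⟨-a / b, ?_⟩
    have : (b : ℝ) ≠ 0 := by exact_mod_cast hb
    push_cast
    field_simp
    linarith
  subst hb
  exact ⟨by simpa using h, rfl⟩

/-- `√2` as an element of `fieldK q`. -/
noncomputable def fieldK.sqrtTwo (q : ℕ) : fieldK q :=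
  ⟨((√2 : ℝ) : ℂ), IntermediateField.subset_adjoin _ _ (by simp)⟩

/-- `√-q` as an element of `fieldK q`. -/
noncomputable def fieldK.sqrtNeg (q : ℕ) : fieldK q :=
  ⟨Complex.I * ((√(q : ℝ) : ℝ) : ℂ), IntermediateField.subset_adjoin _ _ (by simp)⟩

open fieldK

theorem sqrt_two_mul_self_complex : ((√2 : ℝ) : ℂ) * ((√2 : ℝ) : ℂ) = 2 := by
  rw [← Complex.ofReal_mul, Real.mul_self_sqrt (by norm_num)]; simp

theorem I_mul_sqrt_mul_self (q : ℕ) :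
    (Complex.I * ((√(q : ℝ) : ℝ) : ℂ)) * (Complex.I * ((√(q : ℝ) : ℝ) : ℂ)) = -q := by
  rw [mul_mul_mul_comm, Complex.I_mul_I, ← Complex.ofReal_mul, Real.mul_self_sqrt (by positivity)]
  simp

theorem fieldK.sqrtTwo_mul_self (q : ℕ) : sqrtTwo q * sqrtTwo q = 2 :=
  Subtype.ext sqrt_two_mul_self_complex

theorem fieldK.sqrtNeg_mul_self (q : ℕ) : sqrtNeg q * sqrtNeg q = -q :=
  Subtype.ext ((I_mul_sqrt_mul_self q).trans (by simp))

/-- The element `(a + b√2) + (c + d√2)√-q`. -/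
noncomputable def fieldK.ofCoords (q : ℕ) (a b c d : ℚ) : fieldK q :=
  (a + b * sqrtTwo q) + (c + d * sqrtTwo q) * sqrtNeg q

/-- Since the generators are algebraic, the field is generated by them as an algebra, and
the span of `1, √2, √-q, √2√-q` is closed under multiplication. -/
theorem fieldK.exists_ofCoords {q : ℕ} (x : fieldK q) : ∃ a b c d : ℚ, x = ofCoords q a b c d := by
  have halg : ∀ y ∈ ({((√2 : ℝ) : ℂ), Complex.I * ((√(q : ℝ) : ℝ) : ℂ)} : Set ℂ),
      IsAlgebraic ℚ y := by
    intro y hy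
    have h2 : IsAlgebraic ℚ (y ^ 2) := by
      rcases hy with rfl | rfl
      · rw [sq, sqrt_two_mul_self_complex]
        exact_mod_cast isAlgebraic_natCast (R := ℚ) (A := ℂ) 2
      · rw [sq, I_mul_sqrt_mul_self]
        exact (isAlgebraic_natCast q).neg
    exact h2.of_pow two_pos
  obtain ⟨x, hx⟩ := x
  have hx' : x ∈ Algebra.adjoin ℚ ({((√2 : ℝ) : ℂ), Complex.I * ((√(q : ℝ) : ℝ) : ℂ)} : Set ℂ) := by
    rw [← IntermediateField.adjoin_toSubalgebra_of_isAlgebraic halg]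
    exact hx
  suffices h : ∃ a b c d : ℚ, x = ofCoords q a b c d by
    obtain ⟨a, b, c, d, h⟩ := h
    exact ⟨a, b, c, d, Subtype.ext h⟩
  clear hx
  induction hx' using Algebra.adjoin_induction with
  | mem y hy =>
    rcases hy with rfl | rfl
    · exact ⟨0, 1, 0, 0, by simp [ofCoords, sqrtTwo]⟩
    · exact ⟨0, 0, 1, 0, by simp [ofCoords, sqrtNeg]⟩
  | algebraMap r => exact ⟨r, 0, 0, 0, by simp [ofCoords]⟩
  | add y z _ _ hy hz =>
    obtain ⟨a, b, c, d, rfl⟩ := hy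
    obtain ⟨a', b', c', d', rfl⟩ := hz
    refine ⟨a + a', b + b', c + c', d + d', ?_⟩
    simp only [ofCoords]
    push_cast
    ring
  | mul y z _ _ hy hz =>
    obtain ⟨a, b, c, d, rfl⟩ := hy
    obtain ⟨a', b', c', d', rfl⟩ := hz
    refine ⟨a * a' + 2 * b * b' - q * (c * c' + 2 * d * d'), a * b' + b * a' - q * (c * d' + d * c'),
      a * c' + 2 * b * d' + c * a' + 2 * d * b', a * d' + b * c' + c * b' + d * a', ?_⟩
    rw [← MulMemClass.coe_mul]
    congr 1
    simp only [ofCoords]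
    push_cast
    linear_combination
      (b * b' + (b * d' + d * b') * sqrtNeg q + d * d' * (sqrtNeg q) ^ 2 : fieldK q) *
        sqrtTwo_mul_self q +
      (c * c' + 2 * d * d' + (c * d' + d * c') * sqrtTwo q : fieldK q) * sqrtNeg_mul_self q

theorem fieldK.re_ofCoords (q : ℕ) (a b c d : ℚ) : (ofCoords q a b c d : ℂ).re = a + b * √2 := by
  simp [ofCoords, sqrtTwo, sqrtNeg]

theorem fieldK.im_ofCoords (q : ℕ) (a b c d : ℚ) :
    (ofCoords q a b c d : ℂ).im = (c + d * √2) * √q := by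
  simp [ofCoords, sqrtTwo, sqrtNeg]

theorem fieldK.ofCoords_eq_zero {q : ℕ} (hq : 0 < q) {a b c d : ℚ} (h : ofCoords q a b c d = 0) :
    a = 0 ∧ b = 0 ∧ c = 0 ∧ d = 0 := by
  have hre := re_ofCoords q a b c d
  have him := im_ofCoords q a b c d
  rw [h] at hre him
  have hq' : √(q : ℝ) ≠ 0 := by positivity
  obtain ⟨ha, hb⟩ := ratCast_add_ratCast_mul_sqrt_two_eq_zero (by simpa using hre.symm)
  obtain ⟨hc, hd⟩ := ratCast_add_ratCast_mul_sqrt_two_eq_zero (a := c) (b := d)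
    (by simpa [hq'] using him.symm)
  exact ⟨ha, hb, hc, hd⟩

/-- The `ℚ`-linear parametrization of `fieldK q` by coordinates. -/
noncomputable def fieldK.coordsMap (q : ℕ) : (Fin 4 → ℚ) →ₗ[ℚ] fieldK q where
  toFun v := ofCoords q (v 0) (v 1) (v 2) (v 3)
  map_add' v w := by simp only [ofCoords, Pi.add_apply]; push_cast; ring
  map_smul' r v := by
    simp only [ofCoords, Pi.smul_apply, smul_eq_mul, RingHom.id_apply, Algebra.smul_def]
    push_cast
    simp only [eq_ratCast]
    ring

theorem fieldK.coordsMap_bijective {q : ℕ} (hq : 0 < q) : Function.Bijective (coordsMap q) := by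
  constructor
  · refine (injective_iff_map_eq_zero _).mpr fun v hv => ?_
    obtain ⟨h0, h1, h2, h3⟩ := ofCoords_eq_zero hq hv
    ext i
    fin_cases i <;> assumption
  · intro x
    obtain ⟨a, b, c, d, rfl⟩ := exists_ofCoords x
    exact ⟨![a, b, c, d], rfl⟩

theorem fieldK.finrank_eq_four {q : ℕ} (hq : 0 < q) : Module.finrank ℚ (fieldK q) = 4 := by
  rw [← (LinearEquiv.ofBijective _ (coordsMap_bijective hq)).finrank_eq]; simp

theorem fieldK.numberField {q : ℕ} (hq : 0 < q) : NumberField (fieldK q) where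
  to_charZero := inferInstance
  to_finiteDimensional := Module.finite_of_finrank_pos (by rw [finrank_eq_four hq]; norm_num)

/-- An embedding sends `√2` to a real square root `s` of `2` and `√-q` to `i t` for a real
square root `t` of `q`. -/
theorem fieldK.exists_embedding_apply {q : ℕ} (φ : fieldK q →+* ℂ) :
    ∃ s t : ℝ, s ^ 2 = 2 ∧ t ^ 2 = q ∧ φ (sqrtTwo q) = s ∧ φ (sqrtNeg q) = Complex.I * t := by
  have h2 : φ (sqrtTwo q) * φ (sqrtTwo q) = ((√2 : ℝ) : ℂ) * ((√2 : ℝ) : ℂ) := by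
    rw [← map_mul, sqrtTwo_mul_self, sqrt_two_mul_self_complex, map_ofNat]
  have hq : φ (sqrtNeg q) * φ (sqrtNeg q) =
      (Complex.I * ((√(q : ℝ) : ℝ) : ℂ)) * (Complex.I * ((√(q : ℝ) : ℝ) : ℂ)) := by
    rw [← map_mul, sqrtNeg_mul_self, I_mul_sqrt_mul_self, map_neg, map_natCast]
  obtain ⟨s, hs, hs'⟩ : ∃ s : ℝ, s ^ 2 = 2 ∧ φ (sqrtTwo q) = s := by
    rcases mul_self_eq_mul_self_iff.mp h2 with h | h
    · exact ⟨√2, by simp, h⟩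
    · exact ⟨-√2, by simp, by simpa using h⟩
  obtain ⟨t, ht, ht'⟩ : ∃ t : ℝ, t ^ 2 = q ∧ φ (sqrtNeg q) = Complex.I * t := by
    rcases mul_self_eq_mul_self_iff.mp hq with h | h
    · exact ⟨√q, by simp, h⟩
    · exact ⟨-√q, by simp, by simpa using h⟩
  exact ⟨s, t, hs, ht, hs', ht'⟩

theorem fieldK.embedding_ofCoords {q : ℕ} {φ : fieldK q →+* ℂ} {s t : ℝ}
    (hs : φ (sqrtTwo q) = s) (ht : φ (sqrtNeg q) = Complex.I * t) (a b c d : ℚ) :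
    φ (ofCoords q a b c d) = ((a + b * s : ℝ) : ℂ) + Complex.I * ((t * (c + d * s) : ℝ) : ℂ) := by
  simp only [ofCoords, map_add, map_mul, map_ratCast, hs, ht]
  push_cast
  ring

theorem fieldK.embedding_ext {q : ℕ} {φ ψ : fieldK q →+* ℂ}
    (h2 : φ (sqrtTwo q) = ψ (sqrtTwo q)) (hq : φ (sqrtNeg q) = ψ (sqrtNeg q)) : φ = ψ := by
  ext x
  obtain ⟨a, b, c, d, rfl⟩ := exists_ofCoords x
  simp only [ofCoords, map_add, map_mul, map_ratCast, h2, hq]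

/-- Two embeddings that agree on `√2` are equal or complex conjugate. -/
theorem fieldK.embedding_eq_or_eq_conjugate {q : ℕ} {φ ψ : fieldK q →+* ℂ}
    (h2 : φ (sqrtTwo q) = ψ (sqrtTwo q)) : φ = ψ ∨ φ = ComplexEmbedding.conjugate ψ := by
  obtain ⟨s, t, -, ht, hs', ht'⟩ := exists_embedding_apply φ
  obtain ⟨s₁, t₁, -, ht₁, hs₁', ht₁'⟩ := exists_embedding_apply ψ
  rcases sq_eq_sq_iff_eq_or_eq_neg.mp (ht.trans ht₁.symm) with h | h
  · exact Or.inl (embedding_ext h2 (by rw [ht', ht₁', h]))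
  · refine Or.inr (embedding_ext ?_ ?_)
    · rw [h2, ComplexEmbedding.conjugate_coe_eq, hs₁', Complex.conj_ofReal]
    · rw [ht', h, ComplexEmbedding.conjugate_coe_eq, ht₁']
      simp

/-- Otherwise all embeddings would agree on `√2`, hence be equal or conjugate to a single one,
but there are four of them. -/
theorem fieldK.exists_embedding_sqrtTwo_eq_neg {q : ℕ} (hq : 0 < q) :
    ∃ τ : fieldK q →+* ℂ, τ (sqrtTwo q) = ((-√2 : ℝ) : ℂ) := by
  by_contra! H
  have := numberField hq
  have hall (φ : fieldK q →+* ℂ) : φ (sqrtTwo q) = ((√2 : ℝ) : ℂ) := by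
    obtain ⟨s, t, hs, -, hs', -⟩ := exists_embedding_apply φ
    have h2 : √2 ^ 2 = (2 : ℝ) := by simp
    rcases sq_eq_sq_iff_eq_or_eq_neg.mp (hs.trans h2.symm) with h | h
    · rw [hs', h]
    · exact absurd (by rw [hs', h]) (H φ)
  let φ₀ : fieldK q →+* ℂ := (fieldK q).val.toRingHom
  have hcard : Fintype.card (fieldK q →+* ℂ) = 4 := by
    rw [Embeddings.card, finrank_eq_four hq]
  classical
  have hsub : (Finset.univ : Finset (fieldK q →+* ℂ)) ⊆ {φ₀, ComplexEmbedding.conjugate φ₀} := by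
    intro φ _
    rcases embedding_eq_or_eq_conjugate ((hall φ).trans (hall φ₀).symm) with h | h <;> simp [h]
  have := (Finset.card_le_card hsub).trans Finset.card_le_two
  rw [Finset.card_univ, hcard] at this
  omega

theorem fieldK.conjugate_ne {q : ℕ} (hq : 0 < q) (φ : fieldK q →+* ℂ) :
    ComplexEmbedding.conjugate φ ≠ φ := by
  intro h
  obtain ⟨s, t, -, ht, -, ht'⟩ := exists_embedding_apply φ
  have h1 := congrArg Complex.im (RingHom.congr_fun h (sqrtNeg q))
  rw [ComplexEmbedding.conjugate_coe_eq, ht'] at h1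
  simp only [map_mul, Complex.conj_I, Complex.conj_ofReal, Complex.mul_im, Complex.neg_re,
    Complex.neg_im, Complex.I_re, Complex.I_im, Complex.ofReal_re, Complex.ofReal_im] at h1
  have ht0 : t = 0 := by linarith
  have : (q : ℝ) ≠ 0 := by exact_mod_cast hq.ne'
  exact this (by rw [← ht, ht0]; norm_num)

theorem fieldK.isTotallyComplex {q : ℕ} (hq : 0 < q) : IsTotallyComplex (fieldK q) where
  isComplex v := by
    rw [InfinitePlace.isComplex_iff, ComplexEmbedding.isReal_iff]
    exact conjugate_ne hq _

theorem fieldK.nonempty_embeddingOrdering {q : ℕ} (hq : 0 < q) :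
    Nonempty (EmbeddingOrdering (fieldK q)) := by
  have := numberField hq
  obtain ⟨τ, hτ⟩ := exists_embedding_sqrtTwo_eq_neg hq
  let φ : fieldK q →+* ℂ := (fieldK q).val.toRingHom
  have hφ : φ (sqrtTwo q) = ((√2 : ℝ) : ℂ) := rfl
  have hcφ : ComplexEmbedding.conjugate φ (sqrtTwo q) = ((√2 : ℝ) : ℂ) := by
    rw [ComplexEmbedding.conjugate_coe_eq, hφ, Complex.conj_ofReal]
  have hcτ : ComplexEmbedding.conjugate τ (sqrtTwo q) = ((-√2 : ℝ) : ℂ) := by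
    rw [ComplexEmbedding.conjugate_coe_eq, hτ, Complex.conj_ofReal]
  have key {ψ χ : fieldK q →+* ℂ} (hψ : ψ (sqrtTwo q) = ((√2 : ℝ) : ℂ))
      (hχ : χ (sqrtTwo q) = ((-√2 : ℝ) : ℂ)) : ψ ≠ χ := by
    rintro rfl
    have h0 : (0 : ℝ) < √2 := by positivity
    have := Complex.ofReal_injective (hψ.symm.trans hχ)
    linarith
  let f : Fin 4 → (fieldK q →+* ℂ) :=
    ![φ, τ, ComplexEmbedding.conjugate φ, ComplexEmbedding.conjugate τ]
  have hinj : Function.Injective f := by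
    have h1 := key hφ hτ
    have h2 := key hφ hcτ
    have h3 := key hcφ hτ
    have h4 := key hcφ hcτ
    have h5 := conjugate_ne hq φ
    have h6 := conjugate_ne hq τ
    intro i k hik
    fin_cases i <;> fin_cases k <;> first | rfl | (exfalso; simp [f] at hik; grind)
  have hbij : Function.Bijective f := by
    rw [Fintype.bijective_iff_injective_and_card]
    exact ⟨hinj, by rw [Embeddings.card, finrank_eq_four hq, Fintype.card_fin]⟩
  refine ⟨⟨Equiv.ofBijective f hbij, ?_, ?_⟩⟩ <;>
  simp [f, ComplexEmbedding.involutive_conjugate (fieldK q) _]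

/-! ### Distinct parameters give non-isomorphic fields -/

theorem eq_of_mul_sq_eq_natCast {q q' : ℕ} (hq : Squarefree q) (hq' : Squarefree q') {c : ℚ}
    (h : (q : ℚ) * c ^ 2 = q') : q = q' := by
  have hsq : IsSquare (((q * q' : ℕ) : ℚ)) := ⟨q * c, by push_cast; rw [← h]; ring⟩
  obtain ⟨n, hn⟩ := Rat.isSquare_natCast_iff.mp hsq
  have hdvd : q ∣ n := (hq.dvd_pow_iff_dvd two_ne_zero).mp ⟨q', by rw [sq, hn]⟩
  obtain ⟨m, rfl⟩ := hdvd
  have hqm : q' = q * (m * m) := by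
    apply Nat.eq_of_mul_eq_mul_left (Nat.pos_of_ne_zero hq.ne_zero)
    rw [hn]; ring
  have hm : m = 1 := Nat.isUnit_iff.mp (hq' m ⟨q, by rw [hqm]; ring⟩)
  rw [hqm, hm]; ring

theorem two_mul_mul_sq_ne_natCast {q q' : ℕ} (hq : Odd q) (hq' : Odd q') (d : ℚ) :
    2 * (q : ℚ) * d ^ 2 ≠ q' := by
  intro h
  have hsq : IsSquare (((2 * (q * q') : ℕ) : ℚ)) := ⟨2 * q * d, by push_cast; rw [← h]; ring⟩
  obtain ⟨n, hn⟩ := Rat.isSquare_natCast_iff.mp hsq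
  have hne : Even n := by
    have : Even (n * n) := hn ▸ even_two_mul _
    simpa [Nat.even_mul] using this
  obtain ⟨m, rfl⟩ := hne
  have hodd : Odd (q * q') := hq.mul hq'
  have : q * q' = 2 * (m * m) := by linarith
  rw [this] at hodd
  exact Nat.not_odd_iff_even.mpr (even_two_mul _) hodd

/-- A square root of `-q'` in `ℚ(√2, √-q)` is purely imaginary, so `√q' = (c + d√2)√q` with
rational `c, d`; squaring forces `cd = 0`. -/
theorem fieldK.eq_of_mul_self_eq_neg {q q' : ℕ} (hq : Admissible q) (hq' : Admissible q')
    {y : fieldK q} (hy : y * y = -q') : q = q' := by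
  have hodd {n : ℕ} (hn : Admissible n) : Odd n := by
    rw [Nat.odd_iff]; have := hn.mod_eight; omega
  obtain ⟨a, b, c, d, rfl⟩ := exists_ofCoords y
  have hC : (ofCoords q a b c d : ℂ) * (ofCoords q a b c d : ℂ) = -q' := by
    rw [← MulMemClass.coe_mul, hy]; simp
  have hre := congrArg Complex.re hC
  have him := congrArg Complex.im hC
  rw [Complex.mul_re, re_ofCoords, im_ofCoords] at hre
  rw [Complex.mul_im, re_ofCoords, im_ofCoords] at him
  simp only [Complex.neg_re, Complex.neg_im, Complex.natCast_re, Complex.natCast_im,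
    neg_zero] at hre him
  have hq0 : (0 : ℝ) < q := by exact_mod_cast hq.pos
  have hq0' : (0 : ℝ) < q' := by exact_mod_cast hq'.pos
  set X : ℝ := a + b * √2
  set Y : ℝ := (c + d * √2) * √q with hY
  have hX : X = 0 := by
    have hXY : X * Y = 0 := by linarith
    rcases mul_eq_zero.mp hXY with h | h
    · exact h
    · rw [h] at hre
      nlinarith [mul_self_nonneg X]
  have hYq : Y * Y = q' := by rw [hX] at hre; linarith
  have h2 : √2 * √2 = (2 : ℝ) := Real.mul_self_sqrt (by norm_num)
  have hqq : √(q : ℝ) * √(q : ℝ) = q := Real.mul_self_sqrt hq0.le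
  have hrel : ((q * (c ^ 2 + 2 * d ^ 2) - q' : ℚ) : ℝ) + ((2 * q * (c * d) : ℚ) : ℝ) * √2 = 0 := by
    push_cast
    rw [← hYq, hY]
    linear_combination -(q : ℝ) * d ^ 2 * h2 - (c + d * √2) ^ 2 * hqq
  obtain ⟨h0, h1⟩ := ratCast_add_ratCast_mul_sqrt_two_eq_zero hrel
  have hqQ : (q : ℚ) ≠ 0 := by exact_mod_cast hq.pos.ne'
  have hcd : c * d = 0 := by simpa [hqQ] using h1
  rcases mul_eq_zero.mp hcd with rfl | rfl
  · exact absurd (by linarith) (two_mul_mul_sq_ne_natCast (hodd hq) (hodd hq') d)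
  · exact eq_of_mul_sq_eq_natCast hq.1 hq'.1 (c := c) (by linarith)

theorem fieldK.isEmpty_ringEquiv {q q' : ℕ} (hq : Admissible q) (hq' : Admissible q')
    (hne : q ≠ q') : IsEmpty (fieldK q ≃+* fieldK q') := by
  refine ⟨fun f => hne (eq_of_mul_self_eq_neg hq hq' (y := f.symm (sqrtNeg q')) ?_)⟩
  rw [← map_mul, sqrtNeg_mul_self, map_neg, map_natCast]

/-! ### The ring of integers -/

theorem IsIntegral.of_eq {A : Type*} [CommRing A] {x y : A} (h : IsIntegral ℤ x) (e : y = x) :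
    IsIntegral ℤ y := e ▸ h

theorem exists_int_of_isIntegral_ratCast {r : ℚ} (h : IsIntegral ℤ ((r : ℝ) : ℂ)) :
    ∃ n : ℤ, r = n := by
  have h' : IsIntegral ℤ (algebraMap ℚ ℂ r) := by simpa using h
  obtain ⟨n, hn⟩ := IsIntegrallyClosed.isIntegral_iff.mp
    ((isIntegral_algebraMap_iff (algebraMap ℚ ℂ).injective).mp h')
  exact ⟨n, by rw [← hn]; simp⟩

/-- The integers of `ℚ(√2)` are `ℤ[√2]`; integrality of both conjugates is assumed. -/
theorem exists_int_of_isIntegral_add_mul_sqrt_two {a b : ℚ}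
    (h : ∀ s : ℝ, s ^ 2 = 2 → IsIntegral ℤ ((a + b * s : ℝ) : ℂ)) :
    (∃ m : ℤ, a = m) ∧ ∃ n : ℤ, b = n := by
  have hs : √2 ^ 2 = (2 : ℝ) := by simp
  have h1 := h √2 hs
  have h2 := h (-√2) (by simp)
  obtain ⟨m, hm⟩ : ∃ m : ℤ, 2 * a = m := by
    apply exists_int_of_isIntegral_ratCast
    refine (h1.add h2).of_eq ?_
    push_cast; ring
  obtain ⟨k, hk⟩ : ∃ k : ℤ, a ^ 2 - 2 * b ^ 2 = k := by
    apply exists_int_of_isIntegral_ratCast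
    refine (h1.mul h2).of_eq ?_
    rw [← Complex.ofReal_mul]
    congr 1
    push_cast
    linear_combination (b : ℝ) ^ 2 * hs
  -- `(4b)² = 2(m² - 4k)` is an integer, hence so is `4b`.
  obtain ⟨n, hn⟩ : ∃ n : ℤ, 4 * b = n := by
    have : IsIntegral ℤ (4 * b) := by
      refine IsIntegral.of_pow two_pos ?_
      have : (4 * b) ^ 2 = algebraMap ℤ ℚ (2 * (m ^ 2 - 4 * k)) := by
        simp only [eq_intCast]; push_cast; rw [← hm, ← hk]; ring
      rw [this]
      exact isIntegral_algebraMap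
    obtain ⟨n, hn⟩ := IsIntegrallyClosed.isIntegral_iff.mp this
    exact ⟨n, by rw [← hn]; simp⟩
  have hZ : n ^ 2 = 2 * (m ^ 2 - 4 * k) := by
    have : ((n ^ 2 : ℤ) : ℚ) = ((2 * (m ^ 2 - 4 * k) : ℤ) : ℚ) := by
      push_cast; rw [← hm, ← hk, ← hn]; ring
    exact_mod_cast this
  have even_of_sq {x y : ℤ} (hxy : x ^ 2 = 2 * y) : ∃ z, x = 2 * z :=
    (Int.even_pow.mp (hxy ▸ even_two_mul y : Even (x ^ 2))).1.two_dvd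
  obtain ⟨n', rfl⟩ := even_of_sq hZ
  obtain ⟨m', rfl⟩ := even_of_sq (x := m) (y := n' ^ 2 + 2 * k) (by linarith)
  obtain ⟨n'', rfl⟩ := even_of_sq (x := n') (y := m' ^ 2 - k) (by linarith)
  push_cast at hm hn
  exact ⟨⟨m', by linarith⟩, ⟨n'', by linarith⟩⟩

theorem fieldK.exists_embedding_sqrtTwo_eq {q : ℕ} (hq : 0 < q) {s : ℝ} (hs : s ^ 2 = 2) :
    ∃ φ : fieldK q →+* ℂ, φ (sqrtTwo q) = s := by
  have h2 : √2 ^ 2 = (2 : ℝ) := by simp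
  rcases sq_eq_sq_iff_eq_or_eq_neg.mp (hs.trans h2.symm) with rfl | rfl
  · exact ⟨(fieldK q).val.toRingHom, rfl⟩
  · exact exists_embedding_sqrtTwo_eq_neg hq

/-- The trace to `ℚ(√2)` of an integral element is in `ℤ[√2]`. -/
theorem fieldK.exists_int_of_isIntegral {q : ℕ} (hq : 0 < q) {a b c d : ℚ}
    (hx : IsIntegral ℤ (ofCoords q a b c d)) :
    (∃ m : ℤ, 2 * a = m) ∧ ∃ n : ℤ, 2 * b = n := by
  apply exists_int_of_isIntegral_add_mul_sqrt_two
  intro s hs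
  obtain ⟨φ, hφ⟩ := exists_embedding_sqrtTwo_eq hq hs
  obtain ⟨-, t, -, -, -, ht⟩ := exists_embedding_apply φ
  have h1 : IsIntegral ℤ (φ (ofCoords q a b c d)) := hx.map φ.toIntAlgHom
  have h2 : IsIntegral ℤ (ComplexEmbedding.conjugate φ (ofCoords q a b c d)) :=
    hx.map (ComplexEmbedding.conjugate φ).toIntAlgHom
  refine (h1.add h2).of_eq ?_
  rw [ComplexEmbedding.conjugate_coe_eq, embedding_ofCoords hφ ht]
  simp only [map_add, map_mul, Complex.conj_I, Complex.conj_ofReal]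
  push_cast
  ring

/-- The norm to `ℚ(√2)` of an integral element is in `ℤ[√2]`. -/
theorem fieldK.exists_int_norm_of_isIntegral {q : ℕ} (hq : 0 < q) {a b c d : ℚ}
    (hx : IsIntegral ℤ (ofCoords q a b c d)) :
    (∃ m : ℤ, a ^ 2 + 2 * b ^ 2 + q * (c ^ 2 + 2 * d ^ 2) = m) ∧
      ∃ n : ℤ, 2 * (a * b + q * (c * d)) = n := by
  apply exists_int_of_isIntegral_add_mul_sqrt_two
  intro s hs
  obtain ⟨φ, hφ⟩ := exists_embedding_sqrtTwo_eq hq hs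
  obtain ⟨-, t, -, htq, -, ht⟩ := exists_embedding_apply φ
  have h1 : IsIntegral ℤ (φ (ofCoords q a b c d)) := hx.map φ.toIntAlgHom
  have h2 : IsIntegral ℤ (ComplexEmbedding.conjugate φ (ofCoords q a b c d)) :=
    hx.map (ComplexEmbedding.conjugate φ).toIntAlgHom
  refine (h1.mul h2).of_eq ?_
  rw [ComplexEmbedding.conjugate_coe_eq, embedding_ofCoords hφ ht]
  simp only [map_add, map_mul, Complex.conj_I, Complex.conj_ofReal]
  have hsC : (s : ℂ) ^ 2 = 2 := by exact_mod_cast hs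
  have htC : (t : ℂ) ^ 2 = q := by exact_mod_cast htq
  push_cast
  linear_combination (-(b : ℂ) ^ 2 - (t : ℂ) ^ 2 * d ^ 2) * hsC -
    ((c : ℂ) ^ 2 + 2 * d ^ 2 + 2 * c * d * s) * htC +
    (t : ℂ) ^ 2 * (c + d * s) ^ 2 * Complex.I_sq

theorem fieldK.sqrtNeg_isIntegral (q : ℕ) : IsIntegral ℤ (sqrtNeg q) := by
  refine IsIntegral.of_pow two_pos ?_
  rw [sq, sqrtNeg_mul_self]
  exact (map_natCast (algebraMap ℤ (fieldK q)) q ▸ isIntegral_algebraMap).neg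

/-- Trace and norm to `ℚ(√2)` of `x` and of `√-q x` show that `2x` has integral coordinates
(here `q` squarefree enters); the norm then gives the parities. -/
theorem fieldK.exists_int_coords_of_isIntegral {q : ℕ} (hq : Admissible q) {a b c d : ℚ}
    (hx : IsIntegral ℤ (ofCoords q a b c d)) :
    ∃ x : Fin 4 → ℤ, 2 * a = 2 * x 0 + x 2 ∧ 2 * b = 2 * x 1 + x 3 ∧ 2 * c = x 2 ∧
      2 * d = x 3 := by
  have hq8 := hq.mod_eight
  have hqQ : (q : ℚ) ≠ 0 := by exact_mod_cast hq.pos.ne'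
  obtain ⟨⟨A, hA⟩, ⟨B, hB⟩⟩ := exists_int_of_isIntegral hq.pos hx
  have hx' : IsIntegral ℤ (ofCoords q (-(q * c)) (-(q * d)) a b) := by
    refine (hx.mul (sqrtNeg_isIntegral q)).of_eq ?_
    simp only [ofCoords]
    push_cast
    linear_combination -(c + d * sqrtTwo q : fieldK q) * sqrtNeg_mul_self q
  obtain ⟨⟨m, hm⟩, ⟨n, hn⟩⟩ := exists_int_of_isIntegral hq.pos hx'
  obtain ⟨⟨k, hk⟩, ⟨l, hl⟩⟩ := exists_int_norm_of_isIntegral hq.pos hx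
  have hdvd : (q : ℤ) ∣ m ∧ (q : ℤ) ∣ n := by
    refine dvd_of_dvd_sq_add_two_mul_sq (Int.squarefree_natCast.mpr hq.1) ?_ ?_ ?_
    · rw [Int.isCoprime_iff_gcd_eq_one]
      exact_mod_cast (Nat.coprime_two_right.mpr (Nat.odd_iff.mpr (by omega)))
    · refine ⟨4 * k - (A ^ 2 + 2 * B ^ 2), ?_⟩
      have : ((m ^ 2 + 2 * n ^ 2 : ℤ) : ℚ) = ((q * (4 * k - (A ^ 2 + 2 * B ^ 2)) : ℤ) : ℚ) := by
        push_cast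
        rw [← hm, ← hn, ← hA, ← hB, ← hk]
        ring
      exact_mod_cast this
    · refine ⟨2 * l - A * B, ?_⟩
      have : ((m * n : ℤ) : ℚ) = ((q * (2 * l - A * B) : ℤ) : ℚ) := by
        push_cast
        rw [← hm, ← hn, ← hA, ← hB, ← hl]
        ring
      exact_mod_cast this
  obtain ⟨⟨C', rfl⟩, ⟨D', rfl⟩⟩ := hdvd
  have hC : 2 * c = ((-C' : ℤ) : ℚ) := by
    apply mul_left_cancel₀ hqQ
    push_cast at hm ⊢
    linarith
  have hD : 2 * d = ((-D' : ℤ) : ℚ) := by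
    apply mul_left_cancel₀ hqQ
    push_cast at hn ⊢
    linarith
  generalize -C' = C at hC
  generalize -D' = D at hD
  have h4 : 4 ∣ A ^ 2 + 2 * B ^ 2 + (q : ℤ) * (C ^ 2 + 2 * D ^ 2) := by
    refine ⟨k, ?_⟩
    have : ((A ^ 2 + 2 * B ^ 2 + q * (C ^ 2 + 2 * D ^ 2) : ℤ) : ℚ) = ((4 * k : ℤ) : ℚ) := by
      push_cast
      rw [← hA, ← hB, ← hC, ← hD, ← hk]
      ring
    exact_mod_cast this
  obtain ⟨⟨x, hx⟩, ⟨y, hy⟩⟩ := parity_of_four_dvd (by omega) h4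
  have hxQ : (A : ℚ) = 2 * x + C := by exact_mod_cast (by linarith : A = 2 * x + C)
  have hyQ : (B : ℚ) = 2 * y + D := by exact_mod_cast (by linarith : B = 2 * y + D)
  exact ⟨![x, y, C, D], hA.trans hxQ, hB.trans hyQ, hC, hD⟩

theorem fieldK.coe_ofCoords (q : ℕ) (a b c d : ℚ) : (ofCoords q a b c d : ℂ) =
    (a + b * ((√2 : ℝ) : ℂ)) + (c + d * ((√2 : ℝ) : ℂ)) * (Complex.I * ((√(q : ℝ) : ℝ) : ℂ)) := by
  simp [ofCoords, sqrtTwo, sqrtNeg]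

/-- The element `∑ xᵢ αᵢ` as an element of `fieldK q`. -/
noncomputable def fieldK.ofInt (q : ℕ) (x : Fin 4 → ℤ) : fieldK q :=
  ofCoords q (x 0 + x 2 / 2) (x 1 + x 3 / 2) (x 2 / 2) (x 3 / 2)

theorem fieldK.coe_ofInt (q : ℕ) (x : Fin 4 → ℤ) :
    (ofInt q x : ℂ) = ∑ i, (x i : ℂ) * alpha q i := by
  have h : √(2 * (q : ℝ)) = √2 * √(q : ℝ) := Real.sqrt_mul (by norm_num) _
  rw [ofInt, coe_ofCoords]
  simp only [alpha, Fin.sum_univ_four, h]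
  simp
  ring

theorem isIntegral_alpha {q : ℕ} (hq : Admissible q) (i : Fin 4) : IsIntegral ℤ (alpha q i) := by
  have h2 : IsIntegral ℤ (((√2 : ℝ) : ℂ)) := by
    refine IsIntegral.of_pow two_pos ?_
    rw [sq, sqrt_two_mul_self_complex]
    exact map_ofNat (algebraMap ℤ ℂ) 2 ▸ isIntegral_algebraMap
  have h3 : IsIntegral ℤ (alpha q 2) := by
    obtain ⟨k, hk⟩ : ∃ k, q = 4 * k + 3 := ⟨q / 4, by have := hq.mod_eight; omega⟩
    -- `α₃` is a root of `X² - X + (q + 1) / 4`.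
    refine ⟨Polynomial.X ^ 2 - Polynomial.X + Polynomial.C ((k : ℤ) + 1), by monicity!, ?_⟩
    have h := I_mul_sqrt_mul_self q
    have hkC : (q : ℂ) = 4 * k + 3 := by exact_mod_cast hk
    simp [alpha]
    linear_combination h / 4 - hkC / 4
  have h4 : alpha q 3 = ((√2 : ℝ) : ℂ) * alpha q 2 := by
    have h : √(2 * (q : ℝ)) = √2 * √(q : ℝ) := Real.sqrt_mul (by norm_num) _
    simp [alpha, h]
    ring
  fin_cases i
  · exact isIntegral_one
  · exact h2
  · exact h3
  · exact h4 ▸ h2.mul h3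

theorem fieldK.isIntegral_ofInt {q : ℕ} (hq : Admissible q) (x : Fin 4 → ℤ) :
    IsIntegral ℤ (ofInt q x) := by
  have h : IsIntegral ℤ (ofInt q x : ℂ) := by
    rw [coe_ofInt]
    refine IsIntegral.sum _ fun i _ => IsIntegral.mul ?_ (isIntegral_alpha hq i)
    exact eq_intCast (algebraMap ℤ ℂ) (x i) ▸ isIntegral_algebraMap
  exact (isIntegral_algebraMap_iff (A := fieldK q) (B := ℂ) Subtype.val_injective).mp h

/-- The map `x ↦ ∑ xᵢ αᵢ` to the ring of integers. -/
noncomputable def fieldK.intMap {q : ℕ} (hq : Admissible q) : (Fin 4 → ℤ) →ₗ[ℤ] 𝓞 (fieldK q) :=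
  AddMonoidHom.toIntLinearMap
    { toFun := fun x => ⟨ofInt q x, isIntegral_ofInt hq x⟩
      map_zero' := by
        refine RingOfIntegers.ext (Subtype.ext ?_)
        change (ofInt q 0 : ℂ) = 0
        simp [coe_ofInt]
      map_add' := fun x y => by
        refine RingOfIntegers.ext (Subtype.ext ?_)
        change (ofInt q (x + y) : ℂ) = ofInt q x + ofInt q y
        simp [coe_ofInt, add_mul, Finset.sum_add_distrib] }

theorem fieldK.coe_intMap {q : ℕ} (hq : Admissible q) (x : Fin 4 → ℤ) :
    (intMap hq x : fieldK q) = ofInt q x := rfl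

theorem fieldK.intMap_bijective {q : ℕ} (hq : Admissible q) :
    Function.Bijective (intMap hq) := by
  constructor
  · refine (injective_iff_map_eq_zero _).mpr fun x hx => ?_
    have h : ofInt q x = 0 := by rw [← coe_intMap hq, hx]; rfl
    obtain ⟨h0, h1, h2, h3⟩ := ofCoords_eq_zero hq.pos h
    ext i
    have h2' : x 2 = 0 := by simpa using h2
    have h3' : x 3 = 0 := by simpa using h3
    fin_cases i
    · simpa [h2'] using h0
    · simpa [h3'] using h1
    · exact h2'
    · exact h3'
  · intro y
    obtain ⟨a, b, c, d, h⟩ := exists_ofCoords (y : fieldK q)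
    have hy : IsIntegral ℤ (ofCoords q a b c d) := h ▸ y.isIntegral_coe
    obtain ⟨x, h0, h1, h2, h3⟩ := exists_int_coords_of_isIntegral hq hy
    refine ⟨x, RingOfIntegers.ext ?_⟩
    rw [coe_intMap, h, ofInt]
    congr 1 <;> linarith

/-- The coordinates with respect to the integral basis `α₁, …, α₄`. -/
noncomputable def fieldK.intEquiv {q : ℕ} (hq : Admissible q) :
    (Fin 4 → ℤ) ≃ₗ[ℤ] 𝓞 (fieldK q) :=
  LinearEquiv.ofBijective (intMap hq) (intMap_bijective hq)

theorem fieldK.coe_intEquiv {q : ℕ} (hq : Admissible q) (x : Fin 4 → ℤ) :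
    (intEquiv hq x : fieldK q) = ofInt q x := rfl

theorem fieldK.exists_integralBasis {q : ℕ} (hq : Admissible q) :
    ∃ b : Module.Basis (Fin 4) ℤ (𝓞 (fieldK q)), ∀ i, ((b i : fieldK q) : ℂ) = alpha q i := by
  refine ⟨Module.Basis.ofEquivFun (intEquiv hq).symm, fun i => ?_⟩
  rw [Module.Basis.coe_ofEquivFun, LinearEquiv.symm_symm, coe_intEquiv, coe_ofInt]
  simp [Pi.single_apply]

/-! ### The module `M_{j,q}` -/

theorem intEquiv_mem_moduleM {q : ℕ} (hq : Admissible q) (j : ℤ) (x : Fin 4 → ℤ) :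
    intEquiv hq x ∈ moduleM j q ↔ x 2 ≡ -2 * x 0 + j * (2 * x 1 + x 3) [ZMOD q] := by
  constructor
  · rintro ⟨a, ha, ha'⟩
    have : intEquiv hq x = intEquiv hq a := by
      refine RingOfIntegers.ext (Subtype.ext ?_)
      rw [ha, coe_intEquiv, coe_ofInt]
    rwa [(intEquiv hq).injective this]
  · exact fun h => ⟨x, by rw [coe_intEquiv, coe_ofInt], h⟩

/-- `M_{j,q}` is the kernel of a homomorphism onto `ℤ/q`. -/
theorem index_moduleM {q : ℕ} (hq : Admissible q) (j : ℤ) :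
    (moduleM j q).toAddSubgroup.index = q := by
  let g : (Fin 4 → ℤ) →+ ZMod q :=
    { toFun := fun x => ((x 2 + 2 * x 0 - j * (2 * x 1 + x 3) : ℤ) : ZMod q)
      map_zero' := by simp
      map_add' := fun x y => by simp only [Pi.add_apply]; push_cast; ring }
  let h : 𝓞 (fieldK q) →+ ZMod q := g.comp (intEquiv hq).symm.toAddEquiv.toAddMonoidHom
  have hker : (moduleM j q).toAddSubgroup = h.ker := by
    ext y
    obtain ⟨x, rfl⟩ := (intEquiv hq).surjective y
    have hx : h (intEquiv hq x) = g x := congrArg g ((intEquiv hq).symm_apply_apply x)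
    rw [AddMonoidHom.mem_ker, hx, Submodule.mem_toAddSubgroup, intEquiv_mem_moduleM]
    change _ ↔ ((x 2 + 2 * x 0 - j * (2 * x 1 + x 3) : ℤ) : ZMod q) = 0
    rw [ZMod.intCast_zmod_eq_zero_iff_dvd, Int.modEq_comm, Int.modEq_iff_dvd]
    ring_nf
  have hsurj : Function.Surjective h := by
    have hg : Function.Surjective g := fun k => by
      obtain ⟨n, rfl⟩ := ZMod.intCast_surjective k
      exact ⟨![0, 0, n, 0], by simp [g]⟩
    exact hg.comp (intEquiv hq).symm.surjective
  rw [hker, AddSubgroup.index_ker, AddMonoidHom.range_eq_top.mpr hsurj]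
  simp [Nat.card_zmod]

theorem mem_latticeM_iff {q : ℕ} (hq : Admissible q) (j : ℤ) (σ : EmbeddingOrdering (fieldK q))
    (y : EuclideanSpace ℝ (Fin 4)) :
    y ∈ latticeM j q σ ↔ ∃ x : Fin 4 → ℤ,
      x 2 ≡ -2 * x 0 + j * (2 * x 1 + x 3) [ZMOD q] ∧ canonicalEmb σ (ofInt q x) = y := by
  simp only [latticeM, Submodule.mem_map]
  constructor
  · rintro ⟨_, ⟨w, hw, rfl⟩, rfl⟩
    obtain ⟨x, rfl⟩ := (intEquiv hq).surjective w
    exact ⟨x, (intEquiv_mem_moduleM hq j x).mp hw, rfl⟩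
  · rintro ⟨x, hx, rfl⟩
    exact ⟨_, ⟨intEquiv hq x, (intEquiv_mem_moduleM hq j x).mpr hx, rfl⟩, rfl⟩

/-! ### Similarity with `D₄` -/

/-- A linear map scaling all norms by `1 / √q` is `1 / √q` times a linear isometry, so it is a
similarity between a lattice and its image. -/
theorem latticeEquivalent_of_norm_sq {n : ℕ} {L₁ L₂ : Submodule ℤ (EuclideanSpace ℝ (Fin n))}
    {q : ℝ} (hq : 0 < q) (g : EuclideanSpace ℝ (Fin n) →ₗ[ℝ] EuclideanSpace ℝ (Fin n))
    (hg : ∀ y, q * ‖g y‖ ^ 2 = ‖y‖ ^ 2) (himg : g '' (L₁ : Set (EuclideanSpace ℝ (Fin n))) = L₂) :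
    LatticeEquivalent L₁ L₂ := by
  have hq' : 0 < √q := Real.sqrt_pos.mpr hq
  let f : EuclideanSpace ℝ (Fin n) →ₗᵢ[ℝ] EuclideanSpace ℝ (Fin n) :=
    { toLinearMap := √q • g
      norm_map' := fun y => by
        rw [LinearMap.smul_apply, norm_smul, Real.norm_of_nonneg hq'.le]
        refine (sq_eq_sq₀ (by positivity) (norm_nonneg _)).mp ?_
        rw [mul_pow, Real.sq_sqrt hq.le, hg] }
  refine ⟨(√q)⁻¹, f.toLinearIsometryEquiv rfl, inv_pos.mpr hq', ?_⟩
  rw [← himg]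
  refine Set.image_congr fun y _ => ?_
  change (√q)⁻¹ • (√q • g y) = g y
  rw [smul_smul, inv_mul_cancel₀ hq'.ne', one_smul]

/-- With `A = 2x₁ + x₃`, `B = 2x₂ + x₄`, `C = x₃`, `D = x₄`, the congruence defining `M_{j,q}`
is `A ≡ jB (mod q)`. Writing `A + B√-2 = (r + w√-2)(u + v√-2)`, the parities `A ≡ C`, `B ≡ D`
(mod `2`) become `u ≡ C`, `u + v ≡ D`, because `r` and `w` are odd. Hence
`z = ((u + C) / 2, (u - C) / 2, v, D)` runs over the integer vectors with even sum. -/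
theorem modEq_iff_exists_even_sum {q : ℕ} (hq : Admissible q) {j r w : ℤ}
    (hj : j ^ 2 ≡ -2 [ZMOD q]) (hn : r ^ 2 + 2 * w ^ 2 = q) (hrw : r ≡ j * w [ZMOD q])
    (x : Fin 4 → ℤ) :
    x 2 ≡ -2 * x 0 + j * (2 * x 1 + x 3) [ZMOD q] ↔
      ∃ z : Fin 4 → ℤ, Even (∑ i, z i) ∧ 2 * x 0 + x 2 = r * (z 0 + z 1) - 2 * w * z 2 ∧
        2 * x 1 + x 3 = r * z 2 + w * (z 0 + z 1) ∧ x 2 = z 0 - z 1 ∧ x 3 = z 3 := by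
  have hAB : x 2 ≡ -2 * x 0 + j * (2 * x 1 + x 3) [ZMOD q] ↔
      2 * x 0 + x 2 ≡ j * (2 * x 1 + x 3) [ZMOD q] := by
    rw [Int.modEq_iff_dvd, Int.modEq_iff_dvd]
    ring_nf
  rw [hAB, modEq_iff_exists_mul hq.pos hj hn hrw]
  constructor
  · rintro ⟨u, v, hA, hB⟩
    obtain ⟨⟨r', rfl⟩, ⟨w', rfl⟩⟩ := odd_of_sq_add_two_mul_sq hq.mod_eight hn
    have hu : u + x 2 = 2 * (x 0 + x 2 - r' * u + (2 * w' + 1) * v) := by linarith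
    refine ⟨![x 0 + x 2 - r' * u + (2 * w' + 1) * v, x 0 - r' * u + (2 * w' + 1) * v, v, x 3],
      ⟨x 1 + x 3 - r' * v - w' * u, ?_⟩, ?_, ?_, ?_, ?_⟩
    · simp [Fin.sum_univ_four]; linarith
    · simp only [Matrix.cons_val]; linear_combination hA + (2 * r' + 1) * hu
    · simp only [Matrix.cons_val]; linear_combination hB + (2 * w' + 1) * hu
    · simp
    · simp
  · rintro ⟨z, -, hA, hB, -, -⟩
    exact ⟨z 0 + z 1, z 2, hA, hB⟩

theorem exists_coords_of_even_sum {q : ℕ} (hq : Admissible q) {r w : ℤ}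
    (hn : r ^ 2 + 2 * w ^ 2 = q) (z : Fin 4 → ℤ) (hz : Even (∑ i, z i)) :
    ∃ x : Fin 4 → ℤ, 2 * x 0 + x 2 = r * (z 0 + z 1) - 2 * w * z 2 ∧
      2 * x 1 + x 3 = r * z 2 + w * (z 0 + z 1) ∧ x 2 = z 0 - z 1 ∧ x 3 = z 3 := by
  obtain ⟨⟨r', rfl⟩, ⟨w', rfl⟩⟩ := odd_of_sq_add_two_mul_sq hq.mod_eight hn
  obtain ⟨k, hk⟩ := hz
  rw [Fin.sum_univ_four] at hk
  refine ⟨![r' * (z 0 + z 1) + z 1 - (2 * w' + 1) * z 2, r' * z 2 + w' * (z 0 + z 1) + k - z 3,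
    z 0 - z 1, z 3], ?_, ?_, ?_, ?_⟩
  · simp only [Matrix.cons_val]; ring
  · simp only [Matrix.cons_val]; linear_combination -hk
  · simp
  · simp

/-- The first two embeddings of an ordering differ on `√2`, since otherwise they would be equal
or complex conjugate. -/
theorem EmbeddingOrdering.exists_apply {q : ℕ} (σ : EmbeddingOrdering (fieldK q)) :
    ∃ s t t' : ℝ, s ^ 2 = 2 ∧ t ^ 2 = q ∧ t' ^ 2 = q ∧
      σ.toEquiv 0 (sqrtTwo q) = s ∧ σ.toEquiv 0 (sqrtNeg q) = Complex.I * t ∧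
      σ.toEquiv 1 (sqrtTwo q) = ((-s : ℝ) : ℂ) ∧ σ.toEquiv 1 (sqrtNeg q) = Complex.I * t' := by
  obtain ⟨s, t, hs, ht, hs', ht'⟩ := exists_embedding_apply (σ.toEquiv 0)
  obtain ⟨s₁, t₁, hs₁, ht₁, hs₁', ht₁'⟩ := exists_embedding_apply (σ.toEquiv 1)
  refine ⟨s, t, t₁, hs, ht, ht₁, hs', ht', ?_, ht₁'⟩
  rcases sq_eq_sq_iff_eq_or_eq_neg.mp (hs₁.trans hs.symm) with h | h
  · exfalso
    rcases embedding_eq_or_eq_conjugate (hs₁'.trans ((congrArg _ h).trans hs'.symm)) with h | h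
    · exact absurd (σ.toEquiv.injective h) (by decide)
    · rw [← σ.conj_two, ComplexEmbedding.involutive_conjugate] at h
      exact absurd (σ.toEquiv.injective h) (by decide)
  · rw [hs₁', h]

/-- The canonical embedding of `(A + B√2 + C√-q + D√-2q) / 2` has norm squared
`(A² + 2B² + q(C² + 2D²)) / 2`. In terms of the vector `z` of `modEq_iff_exists_even_sum` this is
`q(z₁² + z₂² + z₃² + z₄²)`. -/
theorem latticeEquivalent_latticeM_latticeD {q : ℕ} (hq : Admissible q) {j : ℤ}
    (hj : j ^ 2 ≡ -2 [ZMOD q]) (σ : EmbeddingOrdering (fieldK q)) :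
    LatticeEquivalent (latticeM j q σ) (latticeD 4) := by
  have hqodd : Odd q := by rw [Nat.odd_iff]; have := hq.mod_eight; omega
  obtain ⟨r, w, hn, hrw⟩ := exists_sq_add_two_mul_sq hqodd hj
  obtain ⟨s, t, t', hs, ht, ht', hs0, ht0, hs1, ht1⟩ := σ.exists_apply
  have hqR : (0 : ℝ) < q := by exact_mod_cast hq.pos
  have hq0 := hqR.ne'
  have hnR : (r : ℝ) ^ 2 + 2 * (w : ℝ) ^ 2 = q := by exact_mod_cast hn
  let A : EuclideanSpace ℝ (Fin 4) → ℝ := fun y => y 0 + y 2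
  let B : EuclideanSpace ℝ (Fin 4) → ℝ := fun y => (y 0 - y 2) * s / 2
  let C : EuclideanSpace ℝ (Fin 4) → ℝ := fun y => (t * y 1 + t' * y 3) / q
  let D : EuclideanSpace ℝ (Fin 4) → ℝ := fun y => (t * y 1 - t' * y 3) * s / (2 * q)
  let u : EuclideanSpace ℝ (Fin 4) → ℝ := fun y => (r * A y + 2 * w * B y) / q
  let v : EuclideanSpace ℝ (Fin 4) → ℝ := fun y => (r * B y - w * A y) / q
  let g : EuclideanSpace ℝ (Fin 4) →ₗ[ℝ] EuclideanSpace ℝ (Fin 4) :=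
    { toFun := fun y => !₂[(u y + C y) / 2, (u y - C y) / 2, v y, D y]
      map_add' := fun x y => by
        ext i; fin_cases i <;> simp [u, v, A, B, C, D] <;> ring
      map_smul' := fun a y => by
        ext i; fin_cases i <;> simp [u, v, A, B, C, D] <;> ring }
  refine latticeEquivalent_of_norm_sq hqR g (fun y => ?_) ?_
  · have hAB : A y ^ 2 + 2 * B y ^ 2 = 2 * (y 0 ^ 2 + y 2 ^ 2) := by
      simp only [A, B]
      linear_combination (y 0 - y 2) ^ 2 / 2 * hs
    have hCD : q * (C y ^ 2 + 2 * D y ^ 2) = 2 * (y 1 ^ 2 + y 3 ^ 2) := by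
      simp only [C, D]
      field_simp
      linear_combination (t * y 1 - t' * y 3) ^ 2 * hs + 4 * y 1 ^ 2 * ht + 4 * y 3 ^ 2 * ht'
    have huv : q * (u y ^ 2 + 2 * v y ^ 2) = A y ^ 2 + 2 * B y ^ 2 := by
      simp only [u, v]
      field_simp
      linear_combination (A y ^ 2 + 2 * B y ^ 2) * hnR
    rw [EuclideanSpace.real_norm_sq_eq, EuclideanSpace.real_norm_sq_eq, Fin.sum_univ_four,
      Fin.sum_univ_four]
    change q * (((u y + C y) / 2) ^ 2 + ((u y - C y) / 2) ^ 2 + v y ^ 2 + D y ^ 2) = _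
    linear_combination (huv + hAB + hCD) / 2
  · have key (x z : Fin 4 → ℤ) (hA : 2 * x 0 + x 2 = r * (z 0 + z 1) - 2 * w * z 2)
        (hB : 2 * x 1 + x 3 = r * z 2 + w * (z 0 + z 1)) (hC : x 2 = z 0 - z 1)
        (hD : x 3 = z 3) (i : Fin 4) : g (canonicalEmb σ (ofInt q x)) i = z i := by
      set y := canonicalEmb σ (ofInt q x) with hy
      have hAR : (2 * x 0 + x 2 : ℝ) = r * (z 0 + z 1) - 2 * w * z 2 := by exact_mod_cast hA
      have hBR : (2 * x 1 + x 3 : ℝ) = r * z 2 + w * (z 0 + z 1) := by exact_mod_cast hB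
      have hCR : (x 2 : ℝ) = z 0 - z 1 := by exact_mod_cast hC
      have hDR : (x 3 : ℝ) = z 3 := by exact_mod_cast hD
      have h0 := embedding_ofCoords hs0 ht0 (x 0 + x 2 / 2) (x 1 + x 3 / 2) (x 2 / 2) (x 3 / 2)
      have h1 := embedding_ofCoords hs1 ht1 (x 0 + x 2 / 2) (x 1 + x 3 / 2) (x 2 / 2) (x 3 / 2)
      have y0 : y 0 = (x 0 + x 2 / 2) + (x 1 + x 3 / 2) * s := by
        refine (congrArg Complex.re h0).trans ?_
        simp [sub_eq_add_neg]
      have y1 : y 1 = t * (x 2 / 2 + x 3 / 2 * s) := by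
        refine (congrArg Complex.im h0).trans ?_
        simp [sub_eq_add_neg]
      have y2 : y 2 = (x 0 + x 2 / 2) - (x 1 + x 3 / 2) * s := by
        refine (congrArg Complex.re h1).trans ?_
        simp [sub_eq_add_neg]
      have y3 : y 3 = t' * (x 2 / 2 - x 3 / 2 * s) := by
        refine (congrArg Complex.im h1).trans ?_
        simp [sub_eq_add_neg]
      have eA : A y = 2 * x 0 + x 2 := by simp only [A, y0, y2]; ring
      have eB : B y = 2 * x 1 + x 3 := by
        simp only [B, y0, y2]
        linear_combination (x 1 + x 3 / 2 : ℝ) * hs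
      have eC : C y = x 2 := by
        simp only [C, y1, y3]
        rw [div_eq_iff hq0]
        linear_combination (x 2 / 2 + x 3 / 2 * s : ℝ) * ht + (x 2 / 2 - x 3 / 2 * s : ℝ) * ht'
      have eD : D y = x 3 := by
        simp only [D, y1, y3]
        rw [div_eq_iff (by positivity)]
        linear_combination s * (x 2 / 2 + x 3 / 2 * s : ℝ) * ht -
          s * (x 2 / 2 - x 3 / 2 * s : ℝ) * ht' + q * x 3 * hs
      have eu : u y = z 0 + z 1 := by
        simp only [u, eA, eB]
        rw [div_eq_iff hq0]
        linear_combination (r : ℝ) * hAR + 2 * w * hBR + (z 0 + z 1 : ℝ) * hnR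
      have ev : v y = z 2 := by
        simp only [v, eA, eB]
        rw [div_eq_iff hq0]
        linear_combination (r : ℝ) * hBR - w * hAR + (z 2 : ℝ) * hnR
      fin_cases i
      · change (u y + C y) / 2 = z 0
        rw [eu, eC, hCR]; ring
      · change (u y - C y) / 2 = z 1
        rw [eu, eC, hCR]; ring
      · exact ev
      · exact eD.trans hDR
    ext p
    constructor
    · rintro ⟨y, hy, rfl⟩
      obtain ⟨x, hx, rfl⟩ := (mem_latticeM_iff hq j σ y).mp hy
      obtain ⟨z, hz, hA, hB, hC, hD⟩ := (modEq_iff_exists_even_sum hq hj hn hrw x).mp hx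
      exact ⟨z, key x z hA hB hC hD, hz⟩
    · rintro ⟨z, hp, hz⟩
      obtain ⟨x, hA, hB, hC, hD⟩ := exists_coords_of_even_sum hq hn z hz
      refine ⟨canonicalEmb σ (ofInt q x), (mem_latticeM_iff hq j σ _).mpr ⟨x, ?_, rfl⟩, ?_⟩
      · exact (modEq_iff_exists_even_sum hq hj hn hrw x).mpr ⟨z, hz, hA, hB, hC, hD⟩
      · ext i
        rw [key x z hA hB hC hD i, hp i]

theorem mainTheorem1 :
    (∀ q : ℕ, Admissible q →
      Module.finrank ℚ (fieldK q) = 4 ∧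
      IsTotallyComplex (fieldK q) ∧
      Nonempty (EmbeddingOrdering (fieldK q)) ∧
      (∃ b : Module.Basis (Fin 4) ℤ (𝓞 (fieldK q)),
        ∀ i, ((b i : fieldK q) : ℂ) = alpha q i) ∧
      (∃ j : ℤ, j ^ 2 ≡ -2 [ZMOD q]) ∧
      ∀ j : ℤ, j ^ 2 ≡ -2 [ZMOD q] →
        (moduleM j q).toAddSubgroup.index = q ∧
        ∀ σ : EmbeddingOrdering (fieldK q),
          LatticeEquivalent (latticeM j q σ) (latticeD 4)) ∧
    {q : ℕ | Admissible q}.Infinite ∧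
    (∀ q q' : ℕ, Admissible q → Admissible q' → q ≠ q' →
      IsEmpty (fieldK q ≃+* fieldK q')) :=
  ⟨fun _ hq => ⟨finrank_eq_four hq.pos, isTotallyComplex hq.pos,
    nonempty_embeddingOrdering hq.pos, exists_integralBasis hq, hq.exists_sq_modEq_neg_two,
    fun j hj => ⟨index_moduleM hq j, latticeEquivalent_latticeM_latticeD hq hj⟩⟩,
    infinite_setOf_admissible, fun _ _ hq hq' => isEmpty_ringEquiv hq hq'⟩
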